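/- Modal formulas are built from proposition symbols $p_0,p_1,\dots$ and $\bot$ with $\land,\lor,\to,\Box,\Diamond$; $\neg A$ is $A\to\bot$. Let $\mathcal T$ be a denumerable set of tokens; a position is a finite sequence $\alpha\in\mathcal T^*$, and $A^\alpha$ denotes a modal formula $A$ labelled by a position $\alpha$. For $\mathbb M\in\{\mathsf D,\mathsf T,\mathsf{D4},\mathsf{S4}\}$: *Hilbert system.* $\vdash_{\mathbb M}A$ means that $A$ belongs to the least set of formulas closed under modus ponens and necessitation (from $A$ infer $\Box A$) that contains all instances of $A\to(B\to A)$; $(A\to(B\to C))\to((A\to B)\to(A\to C))$; $(\neg B\to\neg A)\to((\neg B\to A)\to B)$; $\Box(A\to B)\to(\Box A\to\Box B)$; both implications of each of the definitional equivalences of $A\land B$ with $\neg(A\to\neg B)$, of $A\lor B$ with $\neg A\to B$, and of $\Diamond A$ with $\neg\Box\neg A$; and the characteristic axioms: $\Box A\to\Diamond A$ for $\mathsf D$; $\Box A\to A$ for $\mathsf T$; $\Box A\to\Diamond A$ and $\Box A\to\Box\Box A$ for $\mathsf{D4}$; $\Box A\to A$ and $\Box A\to\Box\Box A$ for $\mathsf{S4}$.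 *Natural deduction.* $\mathcal N_{\mathbb M}$ has the usual introduction and elimination rules for $\land,\lor,\to$, where all displayed formulas $A$, $B$ carry one and the same position $\alpha$ (in $\lor$-elimination the conclusion $C^\beta$ may carry any position); classical reductio (from $\bot^\beta$ infer $A^\alpha$, discharging $(\neg A)^\alpha$); from $\bot^\beta$ infer $A^\alpha$ for $A$ atomic (a proposition symbol or $\bot$), with $\alpha\ne\beta$ if $A=\bot$; and the modal rules - $\Box I$: from $A^{\alpha x}$ infer $(\Box A)^\alpha$, where $x\in\mathcal T$ and $\alpha x$ is not a prefix of the position of any open assumption; - $\Box E$: from $(\Box A)^\alpha$ infer $A^{\alpha\beta}$; $\Diamond I$: from $A^{\alpha\beta}$ infer $(\Diamond A)^\alpha$; in both rules $\beta$ must have length $1$ for $\mathsf D$, length at most $1$ for $\mathsf T$, be non-empty for $\mathsf{D4}$, and is arbitrary for $\mathsf{S4}$; - $\Diamond E$: from $(\Diamond A)^\alpha$ and a deduction of $C^\beta$ infer $C^\beta$, discharging $A^{\alpha x}$, where $\alpha x$ is not a prefix of $\beta$ nor of the position of any open assumption of that deduction of $C^\beta$ other than the discharged ones. Write $\vdash_{\mathcal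 N_{\mathbb M}}A^\alpha$ if $A^\alpha$ has a deduction in which every assumption is discharged. **Statement.** For each $\mathbb M\in\{\mathsf D,\mathsf T,\mathsf{D4},\mathsf{S4}\}$ and each modal formula $A$: if $\vdash_{\mathcal N_{\mathbb M}}A^\alpha$ for some position $\alpha$, then $\vdash_{\mathbb M}A$. Moreover, $\vdash_{\mathbb M}A$ if and only if $\vdash_{\mathcal N_{\mathbb M}}A^{\langle\,\rangle}$, where $\langle\,\rangle$ is the empty position. -/

import Mathlib

namespace PositionLogic

/-- Propositional modal formulas over the proposition symbols `p 0, p 1, …`. -/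
inductive Formula : Type
  | p : ℕ → Formula
  | bot : Formula
  | and : Formula → Formula → Formula
  | or : Formula → Formula → Formula
  | imp : Formula → Formula → Formula
  | box : Formula → Formula
  | dia : Formula → Formula

namespace Formula

/-- `¬A` is a shorthand for `A → ⊥`. -/
abbrev neg (A : Formula) : Formula := imp A bot

/-- A formula is atomic if it is a proposition symbol or `⊥`. -/
def IsAtomic : Formula → Prop
  | p _ => True
  | bot => True
  | _ => False

end Formula

/-- The total modal logics. -/
inductive TotalLogic : Type
  | D
  | T
  | D4
  | S4

/-! ### Hilbert-style presentation -/

/-- All instances of `□A → ◇A`. -/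
def schemaD : Set Formula := {F | ∃ A : Formula, F = .imp (.box A) (.dia A)}

/-- All instances of `□A → A`. -/
def schemaT : Set Formula := {F | ∃ A : Formula, F = .imp (.box A) A}

/-- All instances of `□A → □□A`. -/
def schema4 : Set Formula := {F | ∃ A : Formula, F = .imp (.box A) (.box (.box A))}

/-- The normal modal logic axiomatized by the set `Z`: the least set of formulas that contains `Z`
and all instances of the schemas below and is closed under modus ponens and necessitation.
The connectives `∧`, `∨` and `◇`, which the schemas 1, 2, 3, K do not mention, are governed by their
usual definitions `¬(A → ¬B)`, `¬A → B` and `¬□¬A`, stated as pairs of implications. -/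
inductive NormalLogic (Z : Set Formula) : Formula → Prop
  | ax {A : Formula} : A ∈ Z → NormalLogic Z A
  | ax1 (A B : Formula) : NormalLogic Z (.imp A (.imp B A))
  | ax2 (A B C : Formula) :
      NormalLogic Z (.imp (.imp A (.imp B C)) (.imp (.imp A B) (.imp A C)))
  | ax3 (A B : Formula) :
      NormalLogic Z (.imp (.imp B.neg A.neg) (.imp (.imp B.neg A) B))
  | axK (A B : Formula) :
      NormalLogic Z (.imp (.box (.imp A B)) (.imp (.box A) (.box B)))
  | and_def (A B : Formula) :
      NormalLogic Z (.imp (.and A B) (Formula.imp A B.neg).neg)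
  | def_and (A B : Formula) :
      NormalLogic Z (.imp (Formula.imp A B.neg).neg (.and A B))
  | or_def (A B : Formula) :
      NormalLogic Z (.imp (.or A B) (.imp A.neg B))
  | def_or (A B : Formula) :
      NormalLogic Z (.imp (.imp A.neg B) (.or A B))
  | dia_def (A : Formula) :
      NormalLogic Z (.imp (.dia A) (Formula.box A.neg).neg)
  | def_dia (A : Formula) :
      NormalLogic Z (.imp (Formula.box A.neg).neg (.dia A))
  | mp {A B : Formula} : NormalLogic Z A → NormalLogic Z (.imp A B) → NormalLogic Z B
  | nec {A : Formula} : NormalLogic Z A → NormalLogic Z (.box A)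

/-- The axioms characteristic of each logic. -/
def TotalLogic.axioms : TotalLogic → Set Formula
  | .D => schemaD
  | .T => schemaT
  | .D4 => schemaD ∪ schema4
  | .S4 => schemaT ∪ schema4

/-- `A` is a theorem of the Hilbert-style presentation of `M`. -/
def HilbertTheorem (M : TotalLogic) (A : Formula) : Prop := NormalLogic M.axioms A

/-! ### Natural deduction with positions -/

/-- A position formula `A^α`; a position is a finite sequence of tokens. -/
@[ext]
structure PFormula (Tok : Type*) where
  form : Formula
  pos : List Tok

/-- The set of prefixes of the positions occurring in a set of position formulas. -/
def initPos {Tok : Type*} (Γ : Set (PFormula Tok)) : Set (List Tok) :=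
  {β | ∃ φ ∈ Γ, β <+: φ.pos}

/-- The constraint on `β` in the rules `□E` (from `□A^α` infer `A^(αβ)`) and `◇I` (from `A^(αβ)`
infer `◇A^α`). -/
def TotalLogic.Allows {Tok : Type*} : TotalLogic → List Tok → Prop
  | .D, β => β.length = 1
  | .T, β => β.length ≤ 1
  | .D4, β => β ≠ []
  | .S4, _ => True

/-- `Γ'` results from `Γ` by discharging occurrences of the assumption `φ` (possibly none; if only
some of the occurrences are discharged, `φ` remains in `Γ'`). -/
def Discharges {Tok : Type*} (φ : PFormula Tok) (Γ Γ' : Set (PFormula Tok)) : Prop :=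
  Γ \ {φ} ⊆ Γ' ∧ Γ' ⊆ Γ

/-- `Deduction M Γ φ`: there is a deduction in the natural deduction system for `M` whose
conclusion is `φ` and whose set of undischarged assumptions is exactly `Γ`. -/
inductive Deduction {Tok : Type*} (M : TotalLogic) : Set (PFormula Tok) → PFormula Tok → Prop
  | assumption (φ : PFormula Tok) : Deduction M {φ} φ
  | andI {Γ Δ : Set (PFormula Tok)} {A B : Formula} {α : List Tok} :
      Deduction M Γ ⟨A, α⟩ → Deduction M Δ ⟨B, α⟩ → Deduction M (Γ ∪ Δ) ⟨.and A B, α⟩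
  | andE₁ {Γ : Set (PFormula Tok)} {A B : Formula} {α : List Tok} :
      Deduction M Γ ⟨.and A B, α⟩ → Deduction M Γ ⟨A, α⟩
  | andE₂ {Γ : Set (PFormula Tok)} {A B : Formula} {α : List Tok} :
      Deduction M Γ ⟨.and A B, α⟩ → Deduction M Γ ⟨B, α⟩
  | orI₁ {Γ : Set (PFormula Tok)} {A B : Formula} {α : List Tok} :
      Deduction M Γ ⟨A, α⟩ → Deduction M Γ ⟨.or A B, α⟩
  | orI₂ {Γ : Set (PFormula Tok)} {A B : Formula} {α : List Tok} :
      Deduction M Γ ⟨B, α⟩ → Deduction M Γ ⟨.or A B, α⟩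
  | orE {Γ Δ₁ Δ₁' Δ₂ Δ₂' : Set (PFormula Tok)} {A B C : Formula} {α β : List Tok} :
      Deduction M Γ ⟨.or A B, α⟩ →
      Deduction M Δ₁ ⟨C, β⟩ → Discharges ⟨A, α⟩ Δ₁ Δ₁' →
      Deduction M Δ₂ ⟨C, β⟩ → Discharges ⟨B, α⟩ Δ₂ Δ₂' →
      Deduction M (Γ ∪ Δ₁' ∪ Δ₂') ⟨C, β⟩
  | impI {Γ Γ' : Set (PFormula Tok)} {A B : Formula} {α : List Tok} :
      Deduction M Γ ⟨B, α⟩ → Discharges ⟨A, α⟩ Γ Γ' → Deduction M Γ' ⟨.imp A B, α⟩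
  | impE {Γ Δ : Set (PFormula Tok)} {A B : Formula} {α : List Tok} :
      Deduction M Γ ⟨.imp A B, α⟩ → Deduction M Δ ⟨A, α⟩ → Deduction M (Γ ∪ Δ) ⟨B, α⟩
  | botC {Γ Γ' : Set (PFormula Tok)} {A : Formula} {α β : List Tok} :
      Deduction M Γ ⟨.bot, β⟩ → Discharges ⟨A.neg, α⟩ Γ Γ' → Deduction M Γ' ⟨A, α⟩
  | botI {Γ : Set (PFormula Tok)} {A : Formula} {α β : List Tok} :
      A.IsAtomic → (A = .bot → α ≠ β) → Deduction M Γ ⟨.bot, β⟩ → Deduction M Γ ⟨A, α⟩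
  | boxI {Γ : Set (PFormula Tok)} {A : Formula} {α : List Tok} {x : Tok} :
      Deduction M Γ ⟨A, α ++ [x]⟩ → α ++ [x] ∉ initPos Γ → Deduction M Γ ⟨.box A, α⟩
  | boxE {Γ : Set (PFormula Tok)} {A : Formula} {α β : List Tok} :
      M.Allows β → Deduction M Γ ⟨.box A, α⟩ → Deduction M Γ ⟨A, α ++ β⟩
  | diaI {Γ : Set (PFormula Tok)} {A : Formula} {α β : List Tok} :
      M.Allows β → Deduction M Γ ⟨A, α ++ β⟩ → Deduction M Γ ⟨.dia A, α⟩
  | diaE {Γ Δ Δ' : Set (PFormula Tok)} {A C : Formula} {α β : List Tok} {x : Tok} :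
      Deduction M Γ ⟨.dia A, α⟩ →
      Deduction M Δ ⟨C, β⟩ → Discharges ⟨A, α ++ [x]⟩ Δ Δ' →
      ¬ α ++ [x] <+: β → α ++ [x] ∉ initPos Δ' →
      Deduction M (Γ ∪ Δ') ⟨C, β⟩

/-- `Γ ⊢ φ` in the natural deduction system for `M`: some deduction of `φ` has all its undischarged
assumptions in `Γ`. -/
def Derivable {Tok : Type*} (M : TotalLogic) (Γ : Set (PFormula Tok)) (φ : PFormula Tok) : Prop :=
  ∃ Γ' ⊆ Γ, Deduction M Γ' φ

end PositionLogic

/-!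
The two systems are compared through Kripke semantics.

*From natural deduction to Hilbert.* A position assignment sends positions to worlds so that `αx`
is sent to a successor of `α`. Every deduction preserves truth under every such assignment
(`Deduction.sound`). For `□I` and `◇E` the eigenposition condition says that neither the assumptions
nor the conclusion live in the cone of positions extending `αx`; hence the assignment can be changed
on that cone, sending `αx` to any prescribed successor `w` and following successors from there
(`graft`). This is possible because all four logics have serial frames, which is also the reason why
`⊥` may be moved freely between positions. A formula derivable at a position `α` is then true at
every world `w`: adding a root that sees all worlds (`Model.addRoot`) gives an assignment with
`α ↦ w` even if `w` has no predecessors. So the formula is valid, and it is a Hilbert theorem by the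
canonical model (`canonical_truth`, `hilbertTheorem_of_valid`).

*From Hilbert to natural deduction.* Every axiom is derivable at every position and modus ponens is
`→E`. Necessitation is `□I`, since a derivation of `A^(αx)` without assumptions is available by
induction on the Hilbert proof (`HilbertTheorem.derivable`).
-/

namespace PositionLogic

/-! ### Kripke semantics -/

/-- A Kripke model with set of worlds `W`. -/
structure Model (W : Type*) where
  rel : W → W → Prop
  val : W → ℕ → Prop

/-- Truth of a modal formula at a world. -/
def Model.Sat {W : Type*} (K : Model W) : W → Formula → Prop
  | w, .p n => K.val w n
  | _, .bot => False
  | w, .and A B => K.Sat w A ∧ K.Sat w B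
  | w, .or A B => K.Sat w A ∨ K.Sat w B
  | w, .imp A B => K.Sat w A → K.Sat w B
  | w, .box A => ∀ v, K.rel w v → K.Sat v A
  | w, .dia A => ∃ v, K.rel w v ∧ K.Sat v A

/-- The frame condition of each logic. -/
def TotalLogic.Frame {W : Type*} (R : W → W → Prop) : TotalLogic → Prop
  | .D => ∀ w, ∃ v, R w v
  | .T => ∀ w, R w w
  | .D4 => (∀ w, ∃ v, R w v) ∧ ∀ u v w, R u v → R v w → R u w
  | .S4 => (∀ w, R w w) ∧ ∀ u v w, R u v → R v w → R u w

theorem TotalLogic.Frame.serial {W : Type*} {R : W → W → Prop} {M : TotalLogic}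
    (h : M.Frame R) (w : W) : ∃ v, R w v := by
  cases M with
  | D => exact h w
  | T => exact ⟨w, h w⟩
  | D4 => exact h.1 w
  | S4 => exact ⟨w, h.1 w⟩

/-- A position assignment: one-token extensions are sent to successors. -/
def IsAssignment {W Tok : Type*} (R : W → W → Prop) (ρ : List Tok → W) : Prop :=
  ∀ α x, R (ρ α) (ρ (α ++ [x]))

theorem IsAssignment.rel_of_ne_nil {W Tok : Type*} {R : W → W → Prop} {ρ : List Tok → W}
    (hρ : IsAssignment R ρ) (htr : ∀ u v w, R u v → R v w → R u w) (α : List Tok) {β : List Tok}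
    (hβ : β ≠ []) : R (ρ α) (ρ (α ++ β)) := by
  induction β using List.reverseRecOn with
  | nil => exact absurd rfl hβ
  | append_singleton β x ih =>
    rw [← List.append_assoc]
    by_cases h : β = []
    · subst h
      simpa using hρ α x
    · exact htr _ _ _ (ih h) (hρ _ x)

/-- The side condition on `□E` and `◇I` matches the frame condition. -/
theorem TotalLogic.Frame.rel_of_allows {W Tok : Type*} {R : W → W → Prop} {M : TotalLogic}
    (h : M.Frame R) {ρ : List Tok → W} (hρ : IsAssignment R ρ) (α : List Tok) {β : List Tok}
    (hβ : M.Allows β) : R (ρ α) (ρ (α ++ β)) := by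
  cases M with
  | D =>
    obtain ⟨x, rfl⟩ := List.length_eq_one_iff.1 hβ
    exact hρ α x
  | T =>
    match β, hβ with
    | [], _ => simpa using h (ρ α)
    | [x], _ => exact hρ α x
  | D4 => exact hρ.rel_of_ne_nil h.2 α hβ
  | S4 =>
    by_cases hn : β = []
    · subst hn
      simpa using h.1 (ρ α)
    · exact hρ.rel_of_ne_nil h.2 α hn

open Classical in
/-- The map `ρ` changed on the extensions of `π`: `π` is sent to `w`, and each
further token applies the successor function `s`. -/
noncomputable def graft {W Tok : Type*} (ρ : List Tok → W) (π : List Tok) (s : W → W) (w : W)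
    (γ : List Tok) : W :=
  if π <+: γ then s^[γ.length - π.length] w else ρ γ

section Graft

variable {W Tok : Type*} {R : W → W → Prop} {ρ : List Tok → W} {s : W → W} {w : W}

theorem graft_self (π : List Tok) : graft ρ π s w π = w := by
  simp [graft]

theorem graft_of_not_prefix {π γ : List Tok} (h : ¬ π <+: γ) : graft ρ π s w γ = ρ γ := by
  simp [graft, h]

theorem not_concat_prefix_self (α : List Tok) (x : Tok) : ¬ α ++ [x] <+: α := fun h => by
  simpa using h.length_le

/-- Grafting keeps an assignment an assignment if `w` is a successor of the world of the parent of
`π`; there is no condition for `π = []`. -/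
theorem isAssignment_graft (hρ : IsAssignment R ρ) (hs : ∀ v, R v (s v)) {π : List Tok}
    (hw : ∀ α x, α ++ [x] = π → R (ρ α) w) : IsAssignment R (graft ρ π s w) := by
  intro γ y
  by_cases h : π <+: γ
  · have h' : π <+: γ ++ [y] := h.trans (List.prefix_append _ _)
    have hlen : (γ ++ [y]).length - π.length = (γ.length - π.length) + 1 := by
      have := h.length_le
      simp only [List.length_append, List.length_singleton] at this ⊢
      omega
    rw [graft, graft, if_pos h, if_pos h', hlen, Function.iterate_succ_apply']
    exact hs _
  · rw [graft_of_not_prefix h]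
    by_cases h' : π <+: γ ++ [y]
    · obtain he | he := List.prefix_concat_iff.1 h'
      · rw [← he, graft_self]
        exact hw γ y he.symm
      · exact absurd he h
    · rw [graft_of_not_prefix h']
      exact hρ γ y

theorem isAssignment_graft_concat (hρ : IsAssignment R ρ) (hs : ∀ v, R v (s v)) {α : List Tok}
    {x : Tok} (hw : R (ρ α) w) : IsAssignment R (graft ρ (α ++ [x]) s w) :=
  isAssignment_graft hρ hs fun β y h => by rwa [(List.append_inj' h rfl).1]

end Graft

/-- A position formula is true under an assignment if its formula is true at the world of its
position. -/
def Model.PSat {W Tok : Type*} (K : Model W) (ρ : List Tok → W) (φ : PFormula Tok) : Prop :=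
  K.Sat (ρ φ.pos) φ.form

theorem Discharges.psat {W Tok : Type*} {K : Model W} {ρ : List Tok → W} {φ : PFormula Tok}
    {Γ Γ' : Set (PFormula Tok)} (h : Discharges φ Γ Γ') (hΓ : ∀ ψ ∈ Γ', K.PSat ρ ψ)
    (hφ : K.PSat ρ φ) : ∀ ψ ∈ Γ, K.PSat ρ ψ := fun ψ hψ => by
  by_cases he : ψ = φ
  · exact he ▸ hφ
  · exact hΓ ψ (h.1 ⟨hψ, he⟩)

theorem psat_graft {W Tok : Type*} {K : Model W} {ρ : List Tok → W} {s : W → W} {w : W}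
    {Γ : Set (PFormula Tok)} {π : List Tok} (hπ : π ∉ initPos Γ)
    (hΓ : ∀ ψ ∈ Γ, K.PSat ρ ψ) : ∀ ψ ∈ Γ, K.PSat (graft ρ π s w) ψ := fun ψ hψ => by
  rw [Model.PSat, graft_of_not_prefix fun h => hπ ⟨ψ, hψ, h⟩]
  exact hΓ ψ hψ

/-- Deductions preserve truth under every position assignment into a model of the logic. -/
theorem Deduction.sound {W Tok : Type*} {M : TotalLogic} {K : Model W} (hK : M.Frame K.rel)
    {Γ : Set (PFormula Tok)} {φ : PFormula Tok} (d : Deduction M Γ φ) :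
    ∀ ρ : List Tok → W, IsAssignment K.rel ρ → (∀ ψ ∈ Γ, K.PSat ρ ψ) → K.PSat ρ φ := by
  choose s hs using hK.serial
  induction d with
  | assumption φ => exact fun ρ _ h => h φ rfl
  | andI _ _ ih₁ ih₂ =>
    exact fun ρ hρ h =>
      ⟨ih₁ ρ hρ fun ψ hψ => h ψ (.inl hψ), ih₂ ρ hρ fun ψ hψ => h ψ (.inr hψ)⟩
  | andE₁ _ ih => exact fun ρ hρ h => (ih ρ hρ h).1
  | andE₂ _ ih => exact fun ρ hρ h => (ih ρ hρ h).2
  | orI₁ _ ih => exact fun ρ hρ h => .inl (ih ρ hρ h)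
  | orI₂ _ ih => exact fun ρ hρ h => .inr (ih ρ hρ h)
  | orE _ _ hd₁ _ hd₂ ih ih₁ ih₂ =>
    intro ρ hρ h
    obtain hA | hB := ih ρ hρ fun ψ hψ => h ψ (.inl (.inl hψ))
    · exact ih₁ ρ hρ (hd₁.psat (fun ψ hψ => h ψ (.inl (.inr hψ))) hA)
    · exact ih₂ ρ hρ (hd₂.psat (fun ψ hψ => h ψ (.inr hψ)) hB)
  | impI _ hd ih => exact fun ρ hρ h hA => ih ρ hρ (hd.psat h hA)
  | impE _ _ ih₁ ih₂ =>
    exact fun ρ hρ h =>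
      ih₁ ρ hρ (fun ψ hψ => h ψ (.inl hψ)) (ih₂ ρ hρ fun ψ hψ => h ψ (.inr hψ))
  | botC _ hd ih => exact fun ρ hρ h => by_contra fun hA => ih ρ hρ (hd.psat h hA)
  | botI _ _ _ ih => exact fun ρ hρ h => (ih ρ hρ h).elim
  | @boxI Γ A α x _ hx ih =>
    intro ρ hρ h w hw
    have := ih (graft ρ (α ++ [x]) s w) (isAssignment_graft_concat hρ hs hw) (psat_graft hx h)
    rwa [Model.PSat, graft_self] at this
  | boxE hβ _ ih => exact fun ρ hρ h => ih ρ hρ h _ (hK.rel_of_allows hρ _ hβ)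
  | diaI hβ _ ih => exact fun ρ hρ h => ⟨_, hK.rel_of_allows hρ _ hβ, ih ρ hρ h⟩
  | @diaE Γ Δ Δ' A C α β x _ _ hd hβ hx ih₁ ih₂ =>
    intro ρ hρ h
    obtain ⟨w, hw, hA⟩ := ih₁ ρ hρ fun ψ hψ => h ψ (.inl hψ)
    have := ih₂ (graft ρ (α ++ [x]) s w) (isAssignment_graft_concat hρ hs hw)
      (hd.psat (psat_graft hx fun ψ hψ => h ψ (.inr hψ))
        (by rw [Model.PSat, graft_self]; exact hA))
    rwa [Model.PSat, graft_of_not_prefix hβ] at this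

/-- The model `K` with one more world `none`, which sees every world including itself. -/
def Model.addRoot {W : Type*} (K : Model W) : Model (Option W) where
  rel
    | none, _ => True
    | some _, none => False
    | some u, some v => K.rel u v
  val
    | none, _ => False
    | some u, n => K.val u n

theorem TotalLogic.Frame.addRoot {W : Type*} {M : TotalLogic} {K : Model W}
    (h : M.Frame K.rel) : M.Frame K.addRoot.rel := by
  have hser : (∀ w, ∃ v, K.rel w v) → ∀ w, ∃ v, K.addRoot.rel w v := by
    rintro h (_ | w)
    · exact ⟨none, trivial⟩
    · exact (h w).elim fun v hv => ⟨some v, hv⟩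
  have hrefl : (∀ w, K.rel w w) → ∀ w, K.addRoot.rel w w := by
    rintro h (_ | w)
    · trivial
    · exact h w
  have htr : (∀ u v w, K.rel u v → K.rel v w → K.rel u w) →
      ∀ u v w, K.addRoot.rel u v → K.addRoot.rel v w → K.addRoot.rel u w := by
    rintro h (_ | u) (_ | v) (_ | w) h₁ h₂
    all_goals first | trivial | exact h₁.elim | exact h₂.elim | exact h u v w h₁ h₂
  cases M with
  | D => exact hser h
  | T => exact hrefl h
  | D4 => exact ⟨hser h.1, htr h.2⟩
  | S4 => exact ⟨hrefl h.1, htr h.2⟩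

theorem Model.sat_addRoot {W : Type*} (K : Model W) (A : Formula) :
    ∀ w, K.addRoot.Sat (some w) A ↔ K.Sat w A := by
  induction A with
  | p n => exact fun w => Iff.rfl
  | bot => exact fun w => Iff.rfl
  | and A B ihA ihB => exact fun w => and_congr (ihA w) (ihB w)
  | or A B ihA ihB => exact fun w => or_congr (ihA w) (ihB w)
  | imp A B ihA ihB => exact fun w => imp_congr (ihA w) (ihB w)
  | box A ih =>
    refine fun w => ⟨fun h v hv => (ih v).1 (h (some v) hv), fun h v hv => ?_⟩
    cases v with
    | none => exact hv.elim
    | some v => exact (ih v).2 (h v hv)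
  | dia A ih =>
    refine fun w => ⟨?_, fun ⟨v, hv, hA⟩ => ⟨some v, hv, (ih v).2 hA⟩⟩
    rintro ⟨_ | v, hv, hA⟩
    · exact hv.elim
    · exact ⟨v, hv, (ih v).1 hA⟩

/-- A formula derivable at some position is true at every world. The position may be non-empty and
the world without predecessors, so positions outside the cone of `α` are sent to an added root. -/
theorem Derivable.valid {W Tok : Type*} {M : TotalLogic} {K : Model W} (hK : M.Frame K.rel)
    {A : Formula} {α : List Tok} (h : Derivable M (∅ : Set (PFormula Tok)) ⟨A, α⟩) (w : W) :
    K.Sat w A := by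
  obtain ⟨Γ, hΓ, d⟩ := h
  choose s hs using hK.addRoot.serial
  have hρ : IsAssignment K.addRoot.rel (fun _ : List Tok => none) := fun _ _ => trivial
  have := d.sound hK.addRoot (graft (fun _ => none) α s (some w))
    (isAssignment_graft hρ hs fun _ _ _ => trivial) fun ψ hψ => (hΓ hψ).elim
  rw [Model.PSat, graft_self] at this
  exact (K.sat_addRoot A w).1 this

/-! ### Hilbert derivability from assumptions -/

/-- Local derivability: `A` follows by modus ponens from theorems of the normal modal logic of `Z`
and assumptions in `Γ`. Necessitation applies to theorems only, whence the deduction theorem. -/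
inductive Prov (Z Γ : Set Formula) : Formula → Prop
  | hyp {A : Formula} : A ∈ Γ → Prov Z Γ A
  | thm {A : Formula} : NormalLogic Z A → Prov Z Γ A
  | mp {A B : Formula} : Prov Z Γ A → Prov Z Γ (.imp A B) → Prov Z Γ B

namespace Prov

variable {Z Γ Δ : Set Formula} {A B : Formula}

theorem mono (hΓ : Γ ⊆ Δ) (h : Prov Z Γ A) : Prov Z Δ A := by
  induction h with
  | hyp h => exact .hyp (hΓ h)
  | thm h => exact .thm h
  | mp _ _ ih₁ ih₂ => exact .mp ih₁ ih₂

theorem const (A : Formula) (h : Prov Z Γ B) : Prov Z Γ (.imp A B) :=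
  .mp h (.thm (.ax1 B A))

theorem imp_self (A : Formula) : Prov Z Γ (.imp A A) :=
  .mp (.thm (.ax1 A A)) (.mp (.thm (.ax1 A (.imp A A))) (.thm (.ax2 A (.imp A A) A)))

theorem deduction (h : Prov Z (insert A Γ) B) : Prov Z Γ (.imp A B) := by
  induction h with
  | hyp h =>
    obtain rfl | h := h
    · exact imp_self _
    · exact const A (.hyp h)
  | thm h => exact const A (.thm h)
  | mp _ _ ih₁ ih₂ => exact .mp ih₁ (.mp ih₂ (.thm (.ax2 _ _ _)))

theorem of_neg_neg (h : Prov Z Γ A.neg.neg) : Prov Z Γ A :=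
  .mp (imp_self A.neg) (.mp (const A.neg h) (.thm (.ax3 A.neg A)))

theorem of_insert_neg (h : Prov Z (insert A.neg Γ) .bot) : Prov Z Γ A :=
  of_neg_neg (deduction h)

theorem of_bot (h : Prov Z Γ .bot) : Prov Z Γ A :=
  of_insert_neg (h.mono (Set.subset_insert _ _))

theorem normalLogic (h : Prov Z ∅ A) : NormalLogic Z A := by
  induction h with
  | hyp h => exact h.elim
  | thm h => exact h
  | mp _ _ ih₁ ih₂ => exact .mp ih₁ ih₂

theorem box (h : Prov Z {B | .box B ∈ Γ} A) : Prov Z Γ (.box A) := by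
  induction h with
  | hyp h => exact .hyp h
  | thm h => exact .thm (.nec h)
  | mp _ _ ih₁ ih₂ => exact .mp ih₁ (.mp ih₂ (.thm (.axK _ _)))

theorem exists_of_sUnion {c : Set (Set Formula)} (hc : IsChain (· ⊆ ·) c) (hne : c.Nonempty)
    (h : Prov Z (⋃₀ c) A) : ∃ Γ ∈ c, Prov Z Γ A := by
  induction h with
  | hyp h =>
    obtain ⟨Γ, hΓ, hA⟩ := h
    exact ⟨Γ, hΓ, .hyp hA⟩
  | thm h => exact hne.imp fun Γ hΓ => ⟨hΓ, .thm h⟩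
  | mp _ _ ih₁ ih₂ =>
    obtain ⟨Γ, hΓ, h₁⟩ := ih₁
    obtain ⟨Δ, hΔ, h₂⟩ := ih₂
    obtain h | h := hc.total hΓ hΔ
    · exact ⟨Δ, hΔ, .mp (h₁.mono h) h₂⟩
    · exact ⟨Γ, hΓ, .mp h₁ (h₂.mono h)⟩

end Prov

/-! ### Canonical model -/

/-- Maximal consistent sets with respect to the normal modal logic of `Z`. -/
def IsMCS (Z Γ : Set Formula) : Prop := Maximal (fun Δ => ¬ Prov Z Δ .bot) Γ

/-- Lindenbaum's lemma. -/
theorem exists_isMCS {Z Γ : Set Formula} (h : ¬ Prov Z Γ .bot) : ∃ Δ, Γ ⊆ Δ ∧ IsMCS Z Δ := by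
  refine zorn_subset_nonempty {Δ | ¬ Prov Z Δ .bot} (fun c hcS hc hne => ?_) Γ h
  refine ⟨⋃₀ c, fun hp => ?_, fun s hs => Set.subset_sUnion_of_mem hs⟩
  obtain ⟨Δ, hΔ, hp⟩ := hp.exists_of_sUnion hc hne
  exact hcS hΔ hp

namespace IsMCS

variable {Z Γ : Set Formula} {A B : Formula}

theorem bot_notMem (h : IsMCS Z Γ) : .bot ∉ Γ := fun hb => h.1 (.hyp hb)

theorem neg_mem (h : IsMCS Z Γ) (hA : A ∉ Γ) : A.neg ∈ Γ := by
  -- Both `A ∉ Γ` and `¬A ∉ Γ` would make the extensions of `Γ` by `A` and by `¬A` inconsistent.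
  have key : ∀ {C : Formula}, C ∉ Γ → Prov Z (insert C Γ) .bot := fun {C} hC =>
    by_contra fun hn => hC (h.2 hn (Set.subset_insert C Γ) (Set.mem_insert C Γ))
  by_contra hn
  exact h.1 (.mp (.of_insert_neg (key hn)) (.deduction (key hA)))

theorem mem_of_prov (h : IsMCS Z Γ) (hA : Prov Z Γ A) : A ∈ Γ :=
  by_contra fun hn => h.1 (.mp hA (.hyp (h.neg_mem hn)))

theorem mem_imp (h : IsMCS Z Γ) : .imp A B ∈ Γ ↔ (A ∈ Γ → B ∈ Γ) := by
  refine ⟨fun hi hA => h.mem_of_prov (.mp (.hyp hA) (.hyp hi)), fun hi => ?_⟩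
  by_cases hA : A ∈ Γ
  · exact h.mem_of_prov (.const A (.hyp (hi hA)))
  · refine h.mem_of_prov (.deduction (.of_bot (.mp (.hyp (Set.mem_insert A Γ)) (.hyp ?_))))
    exact Set.mem_insert_of_mem _ (h.neg_mem hA)

theorem mem_neg (h : IsMCS Z Γ) : A.neg ∈ Γ ↔ A ∉ Γ := by
  rw [h.mem_imp, iff_false_intro h.bot_notMem]

theorem mem_of_thm (h : IsMCS Z Γ) (hi : NormalLogic Z (.imp A B)) (hA : A ∈ Γ) : B ∈ Γ :=
  h.mem_imp.1 (h.mem_of_prov (.thm hi)) hA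

theorem mem_and (h : IsMCS Z Γ) : .and A B ∈ Γ ↔ A ∈ Γ ∧ B ∈ Γ := by
  have : .and A B ∈ Γ ↔ (Formula.imp A B.neg).neg ∈ Γ :=
    ⟨h.mem_of_thm (.and_def A B), h.mem_of_thm (.def_and A B)⟩
  rw [this, h.mem_neg, h.mem_imp, h.mem_neg]
  tauto

theorem mem_or (h : IsMCS Z Γ) : .or A B ∈ Γ ↔ A ∈ Γ ∨ B ∈ Γ := by
  have : .or A B ∈ Γ ↔ Formula.imp A.neg B ∈ Γ :=
    ⟨h.mem_of_thm (.or_def A B), h.mem_of_thm (.def_or A B)⟩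
  rw [this, h.mem_imp, h.mem_neg]
  tauto

theorem mem_dia (h : IsMCS Z Γ) : .dia A ∈ Γ ↔ .box A.neg ∉ Γ := by
  rw [← h.mem_neg]
  exact ⟨h.mem_of_thm (.dia_def A), h.mem_of_thm (.def_dia A)⟩

end IsMCS

/-- The canonical model of the normal modal logic of `Z`, on its maximal consistent sets. -/
def canonicalModel (Z : Set Formula) : Model {Γ : Set Formula // IsMCS Z Γ} where
  rel Γ Δ := ∀ A, .box A ∈ Γ.1 → A ∈ Δ.1
  val Γ n := .p n ∈ Γ.1

theorem mem_box_iff {Z : Set Formula} (Γ : {Γ : Set Formula // IsMCS Z Γ}) {A : Formula} :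
    .box A ∈ Γ.1 ↔ ∀ Δ, (canonicalModel Z).rel Γ Δ → A ∈ Δ.1 := by
  refine ⟨fun h Δ hΔ => hΔ A h, fun h => by_contra fun hA => ?_⟩
  have hcon : ¬ Prov Z (insert A.neg {B | .box B ∈ Γ.1}) .bot := fun hp =>
    hA (Γ.2.mem_of_prov hp.of_insert_neg.box)
  obtain ⟨Δ, hsub, hΔ⟩ := exists_isMCS hcon
  exact hΔ.mem_neg.1 (hsub (Set.mem_insert _ _))
    (h ⟨Δ, hΔ⟩ fun B hB => hsub (Set.mem_insert_of_mem _ hB))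

theorem canonical_truth {Z : Set Formula} (A : Formula) :
    ∀ Γ : {Γ : Set Formula // IsMCS Z Γ}, (canonicalModel Z).Sat Γ A ↔ A ∈ Γ.1 := by
  induction A with
  | p n => exact fun Γ => Iff.rfl
  | bot => exact fun Γ => ⟨False.elim, Γ.2.bot_notMem⟩
  | and A B ihA ihB => exact fun Γ => by rw [Γ.2.mem_and, ← ihA, ← ihB, Model.Sat]
  | or A B ihA ihB => exact fun Γ => by rw [Γ.2.mem_or, ← ihA, ← ihB, Model.Sat]
  | imp A B ihA ihB => exact fun Γ => by rw [Γ.2.mem_imp, ← ihA, ← ihB, Model.Sat]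
  | box A ih => exact fun Γ => by simp only [mem_box_iff, ← ih, Model.Sat]
  | dia A ih =>
    intro Γ
    rw [Γ.2.mem_dia, mem_box_iff, Model.Sat]
    push Not
    exact exists_congr fun Δ => and_congr_right fun _ => by rw [ih, Δ.2.mem_neg, not_not]

theorem canonical_refl {Z : Set Formula} (hZ : schemaT ⊆ Z)
    (Γ : {Γ : Set Formula // IsMCS Z Γ}) : (canonicalModel Z).rel Γ Γ :=
  fun A => Γ.2.mem_of_thm (.ax (hZ ⟨A, rfl⟩))

theorem canonical_trans {Z : Set Formula} (hZ : schema4 ⊆ Z)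
    (Γ Δ Θ : {Γ : Set Formula // IsMCS Z Γ}) (h₁ : (canonicalModel Z).rel Γ Δ)
    (h₂ : (canonicalModel Z).rel Δ Θ) : (canonicalModel Z).rel Γ Θ :=
  fun A hA => h₂ A (h₁ _ (Γ.2.mem_of_thm (.ax (hZ ⟨A, rfl⟩)) hA))

theorem canonical_serial {Z : Set Formula} (hZ : schemaD ⊆ Z)
    (Γ : {Γ : Set Formula // IsMCS Z Γ}) : ∃ Δ, (canonicalModel Z).rel Γ Δ := by
  -- `□⊤` is a theorem, so axiom D puts `◇⊤` into `Γ`.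
  have htop : .box (.imp .bot .bot) ∈ Γ.1 :=
    Γ.2.mem_of_prov (.thm (.nec (Prov.imp_self (Γ := ∅) _).normalLogic))
  have hdia := (canonical_truth _ Γ).2 (Γ.2.mem_of_thm (.ax (hZ ⟨_, rfl⟩)) htop)
  exact hdia.imp fun _ h => h.1

theorem canonical_frame (M : TotalLogic) : M.Frame (canonicalModel M.axioms).rel := by
  cases M with
  | D => exact canonical_serial subset_rfl
  | T => exact canonical_refl subset_rfl
  | D4 => exact ⟨canonical_serial Set.subset_union_left, canonical_trans Set.subset_union_right⟩
  | S4 => exact ⟨canonical_refl Set.subset_union_left, canonical_trans Set.subset_union_right⟩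

/-- Completeness of the Hilbert system, with the canonical model as the only test model. -/
theorem hilbertTheorem_of_valid {M : TotalLogic} {A : Formula}
    (h : ∀ Γ, (canonicalModel M.axioms).Sat Γ A) : HilbertTheorem M A := by
  refine Prov.normalLogic (Prov.of_insert_neg (by_contra fun hcon => ?_))
  obtain ⟨Γ, hsub, hΓ⟩ := exists_isMCS hcon
  exact hΓ.mem_neg.1 (hsub (Set.mem_insert _ _)) ((canonical_truth A _).1 (h ⟨Γ, hΓ⟩))

theorem Derivable.hilbertTheorem {Tok : Type*} {M : TotalLogic} {A : Formula} {α : List Tok}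
    (h : Derivable M (∅ : Set (PFormula Tok)) ⟨A, α⟩) : HilbertTheorem M A :=
  hilbertTheorem_of_valid fun Γ => h.valid (canonical_frame M) Γ

/-! ### Derived rules of natural deduction -/

namespace Derivable

variable {Tok : Type*} {M : TotalLogic} {Γ Δ : Set (PFormula Tok)} {A B C : Formula}
  {α β : List Tok} {x : Tok}

theorem of_mem {φ : PFormula Tok} (h : φ ∈ Γ) : Derivable M Γ φ :=
  ⟨{φ}, Set.singleton_subset_iff.2 h, .assumption φ⟩

theorem mono {φ : PFormula Tok} (hΓ : Γ ⊆ Δ) (h : Derivable M Γ φ) : Derivable M Δ φ :=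
  let ⟨Γ', h', d⟩ := h
  ⟨Γ', h'.trans hΓ, d⟩

theorem discharges_diff (φ : PFormula Tok) (Γ : Set (PFormula Tok)) :
    Discharges φ Γ (Γ \ {φ}) :=
  ⟨subset_rfl, Set.sdiff_subset⟩

theorem diff_subset_of_subset_insert {φ : PFormula Tok} (h : Δ ⊆ insert φ Γ) :
    Δ \ {φ} ⊆ Γ :=
  Set.sdiff_singleton_subset_iff.2 h

theorem andI (h₁ : Derivable M Γ ⟨A, α⟩) (h₂ : Derivable M Γ ⟨B, α⟩) :
    Derivable M Γ ⟨.and A B, α⟩ :=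
  let ⟨_, s₁, d₁⟩ := h₁
  let ⟨_, s₂, d₂⟩ := h₂
  ⟨_, Set.union_subset s₁ s₂, .andI d₁ d₂⟩

theorem andE₁ (h : Derivable M Γ ⟨.and A B, α⟩) : Derivable M Γ ⟨A, α⟩ :=
  let ⟨_, s, d⟩ := h
  ⟨_, s, .andE₁ d⟩

theorem andE₂ (h : Derivable M Γ ⟨.and A B, α⟩) : Derivable M Γ ⟨B, α⟩ :=
  let ⟨_, s, d⟩ := h
  ⟨_, s, .andE₂ d⟩

theorem orI₁ (h : Derivable M Γ ⟨A, α⟩) : Derivable M Γ ⟨.or A B, α⟩ :=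
  let ⟨_, s, d⟩ := h
  ⟨_, s, .orI₁ d⟩

theorem orI₂ (h : Derivable M Γ ⟨B, α⟩) : Derivable M Γ ⟨.or A B, α⟩ :=
  let ⟨_, s, d⟩ := h
  ⟨_, s, .orI₂ d⟩

theorem orE (h : Derivable M Γ ⟨.or A B, α⟩) (h₁ : Derivable M (insert ⟨A, α⟩ Γ) ⟨C, β⟩)
    (h₂ : Derivable M (insert ⟨B, α⟩ Γ) ⟨C, β⟩) : Derivable M Γ ⟨C, β⟩ :=
  let ⟨_, s, d⟩ := h
  let ⟨_, s₁, d₁⟩ := h₁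
  let ⟨_, s₂, d₂⟩ := h₂
  ⟨_, Set.union_subset (Set.union_subset s (diff_subset_of_subset_insert s₁))
    (diff_subset_of_subset_insert s₂), .orE d d₁ (discharges_diff _ _) d₂ (discharges_diff _ _)⟩

theorem impI (h : Derivable M (insert ⟨A, α⟩ Γ) ⟨B, α⟩) : Derivable M Γ ⟨.imp A B, α⟩ :=
  let ⟨_, s, d⟩ := h
  ⟨_, diff_subset_of_subset_insert s, .impI d (discharges_diff _ _)⟩

theorem impE (h₁ : Derivable M Γ ⟨.imp A B, α⟩) (h₂ : Derivable M Γ ⟨A, α⟩) :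
    Derivable M Γ ⟨B, α⟩ :=
  let ⟨_, s₁, d₁⟩ := h₁
  let ⟨_, s₂, d₂⟩ := h₂
  ⟨_, Set.union_subset s₁ s₂, .impE d₁ d₂⟩

theorem botC (h : Derivable M (insert ⟨A.neg, α⟩ Γ) ⟨.bot, β⟩) : Derivable M Γ ⟨A, α⟩ :=
  let ⟨_, s, d⟩ := h
  ⟨_, diff_subset_of_subset_insert s, .botC d (discharges_diff _ _)⟩

/-- Ex falso across positions: reductio with nothing discharged. -/
theorem of_bot (h : Derivable M Γ ⟨.bot, β⟩) : Derivable M Γ ⟨A, α⟩ :=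
  botC (h.mono (Set.subset_insert _ _))

theorem boxI (hx : α ++ [x] ∉ initPos Γ) (h : Derivable M Γ ⟨A, α ++ [x]⟩) :
    Derivable M Γ ⟨.box A, α⟩ :=
  let ⟨_, s, d⟩ := h
  ⟨_, s, .boxI d fun ⟨φ, hφ, hp⟩ => hx ⟨φ, s hφ, hp⟩⟩

theorem boxE (hβ : M.Allows β) (h : Derivable M Γ ⟨.box A, α⟩) : Derivable M Γ ⟨A, α ++ β⟩ :=
  let ⟨_, s, d⟩ := h
  ⟨_, s, .boxE hβ d⟩

theorem diaI (hβ : M.Allows β) (h : Derivable M Γ ⟨A, α ++ β⟩) : Derivable M Γ ⟨.dia A, α⟩ :=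
  let ⟨_, s, d⟩ := h
  ⟨_, s, .diaI hβ d⟩

theorem diaE (hβ : ¬ α ++ [x] <+: β) (hx : α ++ [x] ∉ initPos Γ)
    (h₁ : Derivable M Γ ⟨.dia A, α⟩) (h₂ : Derivable M (insert ⟨A, α ++ [x]⟩ Γ) ⟨C, β⟩) :
    Derivable M Γ ⟨C, β⟩ :=
  let ⟨_, s₁, d₁⟩ := h₁
  let ⟨_, s₂, d₂⟩ := h₂
  have s₂' := diff_subset_of_subset_insert s₂
  ⟨_, Set.union_subset s₁ s₂', .diaE d₁ d₂ (discharges_diff _ _) hβ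
    fun ⟨φ, hφ, hp⟩ => hx ⟨φ, s₂' hφ, hp⟩⟩

end Derivable

/-! ### Derivability of the Hilbert axioms -/

theorem TotalLogic.allows_singleton {Tok : Type*} (M : TotalLogic) (x : Tok) : M.Allows [x] := by
  cases M <;> simp [TotalLogic.Allows]

/-- The eigenposition condition holds for every position longer than the common position `α` of the
assumptions. -/
theorem notMem_initPos {Tok : Type*} {Γ : Set (PFormula Tok)} {α : List Tok}
    (hΓ : ∀ φ ∈ Γ, φ.pos = α) {π : List Tok} (hπ : α.length < π.length) : π ∉ initPos Γ := by
  rintro ⟨φ, hφ, hp⟩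
  rw [hΓ φ hφ] at hp
  exact absurd hp.length_le (not_le.2 hπ)

section Axioms

variable {Tok : Type*} {M : TotalLogic}

open Derivable

theorem derivable_schemaD [Nonempty Tok] (A : Formula) (α : List Tok) :
    Derivable M (∅ : Set (PFormula Tok)) ⟨.imp (.box A) (.dia A), α⟩ := by
  obtain ⟨x⟩ := ‹Nonempty Tok›
  exact impI (diaI (M.allows_singleton x) (boxE (M.allows_singleton x) (of_mem (by simp))))

theorem derivable_schemaT (hM : M.Allows ([] : List Tok)) (A : Formula) (α : List Tok) :
    Derivable M (∅ : Set (PFormula Tok)) ⟨.imp (.box A) A, α⟩ := by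
  have h : Derivable M {⟨.box A, α⟩} (⟨A, α ++ []⟩ : PFormula Tok) := boxE hM (of_mem rfl)
  rw [List.append_nil] at h
  exact impI (by simpa using h)

theorem derivable_schema4 [Nonempty Tok] (hM : ∀ x y : Tok, M.Allows [x, y]) (A : Formula)
    (α : List Tok) :
    Derivable M (∅ : Set (PFormula Tok)) ⟨.imp (.box A) (.box (.box A)), α⟩ := by
  obtain ⟨x⟩ := ‹Nonempty Tok›
  refine impI (boxI (x := x) (notMem_initPos (α := α) (by simp) (by simp))
    (boxI (x := x) (notMem_initPos (α := α) (by simp) (by simp)) ?_))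
  rw [List.append_assoc]
  exact boxE (hM x x) (of_mem (by simp))

theorem derivable_of_mem_axioms [Nonempty Tok] {A : Formula} (h : A ∈ M.axioms) (α : List Tok) :
    Derivable M (∅ : Set (PFormula Tok)) ⟨A, α⟩ := by
  cases M with
  | D =>
    obtain ⟨A, rfl⟩ := h
    exact derivable_schemaD A α
  | T =>
    obtain ⟨A, rfl⟩ := h
    exact derivable_schemaT (by simp [TotalLogic.Allows]) A α
  | D4 =>
    obtain ⟨A, rfl⟩ | ⟨A, rfl⟩ := h
    · exact derivable_schemaD A α
    · exact derivable_schema4 (by simp [TotalLogic.Allows]) A α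
  | S4 =>
    obtain ⟨A, rfl⟩ | ⟨A, rfl⟩ := h
    · exact derivable_schemaT (by simp [TotalLogic.Allows]) A α
    · exact derivable_schema4 (by simp [TotalLogic.Allows]) A α

theorem derivable_axK [Nonempty Tok] (A B : Formula) (α : List Tok) :
    Derivable M (∅ : Set (PFormula Tok))
      ⟨.imp (.box (.imp A B)) (.imp (.box A) (.box B)), α⟩ := by
  obtain ⟨x⟩ := ‹Nonempty Tok›
  have hx := M.allows_singleton x
  exact impI (impI (boxI (x := x) (notMem_initPos (α := α) (by simp) (by simp))
    (impE (A := A) (boxE hx (of_mem (by simp))) (boxE hx (of_mem (by simp))))))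

theorem derivable_dia_def [Nonempty Tok] (A : Formula) (α : List Tok) :
    Derivable M (∅ : Set (PFormula Tok)) ⟨.imp (.dia A) (Formula.box A.neg).neg, α⟩ := by
  obtain ⟨x⟩ := ‹Nonempty Tok›
  -- The contradiction arises at `αx`, and has to be moved to `α` before `◇E` applies.
  exact impI (impI (diaE (A := A) (x := x) (not_concat_prefix_self α x)
    (notMem_initPos (α := α) (by simp) (by simp)) (of_mem (by simp))
    (of_bot (β := α ++ [x]) (impE (A := A)
      (boxE (M.allows_singleton x) (of_mem (by simp))) (of_mem (by simp))))))

theorem derivable_def_dia [Nonempty Tok] (A : Formula) (α : List Tok) :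
    Derivable M (∅ : Set (PFormula Tok)) ⟨.imp (Formula.box A.neg).neg (.dia A), α⟩ := by
  obtain ⟨x⟩ := ‹Nonempty Tok›
  exact impI (botC (β := α) (impE (A := .box A.neg) (of_mem (by simp))
    (boxI (x := x) (notMem_initPos (α := α) (by simp) (by simp))
      (impI (of_bot (β := α) (impE (A := .dia A) (of_mem (by simp))
        (diaI (M.allows_singleton x) (of_mem (by simp)))))))))

theorem HilbertTheorem.derivable [Nonempty Tok] {A : Formula} (h : HilbertTheorem M A) :
    ∀ α : List Tok, Derivable M (∅ : Set (PFormula Tok)) ⟨A, α⟩ := by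
  induction h with
  | ax h => exact derivable_of_mem_axioms h
  | ax1 A B => exact fun α => impI (impI (of_mem (by simp)))
  | ax2 A B C =>
    exact fun α => impI (impI (impI (impE (A := B)
      (impE (A := A) (of_mem (by simp)) (of_mem (by simp)))
      (impE (A := A) (of_mem (by simp)) (of_mem (by simp))))))
  | ax3 A B =>
    exact fun α => impI (impI (botC (β := α) (impE (A := A)
      (impE (A := B.neg) (of_mem (by simp)) (of_mem (by simp)))
      (impE (A := B.neg) (of_mem (by simp)) (of_mem (by simp))))))
  | axK A B => exact derivable_axK A B
  | and_def A B =>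
    exact fun α => impI (impI (impE (A := B)
      (impE (A := A) (of_mem (by simp)) (andE₁ (B := B) (of_mem (by simp))))
      (andE₂ (A := A) (of_mem (by simp)))))
  | def_and A B =>
    exact fun α => impI (botC (β := α) (impE (A := .imp A B.neg) (of_mem (by simp))
      (impI (impI (impE (A := .and A B) (of_mem (by simp))
        (andI (of_mem (by simp)) (of_mem (by simp))))))))
  | or_def A B =>
    exact fun α => impI (impI (orE (A := A) (B := B) (α := α) (of_mem (by simp))
      (of_bot (β := α) (impE (A := A) (of_mem (by simp)) (of_mem (by simp))))
      (of_mem (by simp))))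
  | def_or A B =>
    exact fun α => impI (botC (β := α) (impE (A := .or A B) (of_mem (by simp))
      (orI₂ (impE (A := A.neg) (of_mem (by simp))
        (impI (impE (A := .or A B) (of_mem (by simp)) (orI₁ (of_mem (by simp)))))))))
  | dia_def A => exact derivable_dia_def A
  | def_dia A => exact derivable_def_dia A
  | mp _ _ ih₁ ih₂ => exact fun α => impE (ih₂ α) (ih₁ α)
  | nec _ ih =>
    obtain ⟨x⟩ := ‹Nonempty Tok›
    exact fun α => boxI (x := x) (fun ⟨_, h, _⟩ => h) (ih (α ++ [x]))

end Axioms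

end PositionLogic

theorem mainTheorem6 {Tok : Type*} [Countable Tok] [Infinite Tok]
    (M : PositionLogic.TotalLogic) (A : PositionLogic.Formula) :
    (∀ α : List Tok,
      PositionLogic.Derivable M (∅ : Set (PositionLogic.PFormula Tok)) ⟨A, α⟩ →
        PositionLogic.HilbertTheorem M A) ∧
    (PositionLogic.HilbertTheorem M A ↔
      PositionLogic.Derivable M (∅ : Set (PositionLogic.PFormula Tok)) ⟨A, []⟩) :=
  ⟨fun _ h => h.hilbertTheorem, fun h => h.derivable [], fun h => h.hilbertTheorem⟩
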